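/- Let $(x,y)$ be a square-integrable random vector in $\mathbb{R}^d\times\mathbb{R}$ such that the Hessian matrix $H:=E(xx^T)$ is positive-definite, and let $\theta^*\in\mathbb{R}^d$ be the solution of $H\theta^*=E(yx)$. Write $\|v\|_H:=\|\sqrt{H}\,v\|$, so that $\|v\|_H^2=v^THv$. Assume that there are $\sigma,R>0$ such that the matrices $E((y-x^T\theta^*)^2xx^T)$ and $E(\|x\|^2xx^T)$ are well defined and $$E\big((y-x^T\theta^*)^2xx^T\big)\preccurlyeq\sigma^2H,\qquad E\big(\|x\|^2xx^T\big)\preccurlyeq R^2H,$$ where $A\preccurlyeq B$ means that $B-A$ is positive semi-definite. Let $0<\gamma<2/R^2$, $\theta_0\in\mathbb{R}^d$, $\delta>1$, $0<\alpha\le 1/2$, let $k\ge2$ be an integer, and let the burn-in period $s$ be an integer with $\lfloor\alpha k\rfloor\le s\le\lceil\alpha k\rceil$. Let $(x_t,y_t)$, $t\in\mathbb{Z}$, be independent copies of $(x,y)$. For $m\in\mathbb{Z}$ let $\theta_{m:m}:=\theta_0$ and $$\theta_{m:t+1}:=\theta_{m:t}-\gamma\,(x_t^T\theta_{m:t}-y_t)\,x_t\quad(t\ge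 m),\qquad \theta_t:=\theta_{0:t}\quad(t\ge0),\qquad \bar\theta_k:=\frac1{k-s}\sum_{t=s}^{k-1}\theta_t .$$ Let $\tau_0$ be uniformly distributed on $\{s,\dots,k-1\}$ and, for $l\ge1$, let $\tau_l$ be uniformly distributed on $\{k(2^l-1),\dots,k(2^{l+1}-1)-1\}$, where the random variables $\tau_l$, $l\ge0$, and $(x_t,y_t)$, $t\in\mathbb{Z}$, are independent. Put $f_{k,l}:=\theta_{-\tau_l:0}$ for $l\ge 0$. Let $N$ be a random variable with values in $\{0,1,2,\dots\}$, independent of $((\tau_l)_{l\ge0},(x_t,y_t)_{t\in\mathbb{Z}})$, with $$\Pr(N=l)=p_l:=\frac1{2^l(l+1)^\delta}-\frac1{2^{l+1}(l+2)^\delta}\quad(l\ge0),\qquad\text{and let}\qquad Z_k:=\frac{f_{k,N+1}-f_{k,N}}{p_N}.$$ Let $n'\ge1$ be an integer, let $\tilde Z_k$ be a copy of $Z_k$ and let $x^{(1)},\dots,x^{(n')}$ be copies of $x$ such that $Z_k,\tilde Z_k,x^{(1)},\dots,x^{(n')}$ are independent. Then $\bar\theta_k$ and $\frac1{n'}\sum_{j=1}^{n'}(Z_k^Tx^{(j)})(\tilde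 Z_k^Tx^{(j)})$ are integrable, and $$E\left(\frac1{n'}\sum_{j=1}^{n'}(Z_k^Tx^{(j)})(\tilde Z_k^Tx^{(j)})\right)=\|E(\bar\theta_k)-\theta^*\|_H^2 .$$ Thus the average on the left, which is formed without using $H$ or $\theta^*$, is an unbiased estimator of the squared bias of $\bar\theta_k$. -/

import Mathlib

open MeasureTheory ProbabilityTheory
open scoped MatrixOrder Matrix

/-- Column vectors of dimension `d`, with the Euclidean norm. -/
abbrev Vec (d : ℕ) : Type := EuclideanSpace ℝ (Fin d)

/-- The outer product `v vᵀ`. -/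
def outer {d : ℕ} (v : Vec d) : Matrix (Fin d) (Fin d) ℝ :=
  Matrix.of fun i j => v i * v j

/-- The norm `‖v‖_Σ = ‖√Σ v‖` attached to a positive semi-definite matrix `Σ` (here `S`). -/
noncomputable def weightedNorm {d : ℕ} (S : Matrix (Fin d) (Fin d) ℝ) (v : Vec d) : ℝ :=
  ‖Matrix.toEuclideanLin (CFC.sqrt S) v‖

/-- For positive semi-definite `Σ`, one has `‖v‖_Σ² = vᵀ Σ v`. -/
theorem weightedNorm_sq {d : ℕ} {S : Matrix (Fin d) (Fin d) ℝ} (hS : S.PosSemidef) (v : Vec d) :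
    weightedNorm S v ^ 2 = v.ofLp ⬝ᵥ (S *ᵥ v.ofLp) := by
  have h1 : (CFC.sqrt S)ᵀ = CFC.sqrt S := by
    have := (Matrix.nonneg_iff_posSemidef.mp (CFC.sqrt_nonneg S)).isHermitian
    simpa [Matrix.IsHermitian, Matrix.conjTranspose_eq_transpose_of_trivial] using this
  have h2 : CFC.sqrt S * CFC.sqrt S = S :=
    CFC.sqrt_mul_sqrt_self S (Matrix.nonneg_iff_posSemidef.mpr hS)
  unfold weightedNorm
  rw [← real_inner_self_eq_norm_sq, EuclideanSpace.inner_eq_star_dotProduct]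
  simp only [star_trivial, Matrix.ofLp_toLpLin, Matrix.toLin'_apply]
  conv_rhs => rw [← h2]
  rw [← Matrix.mulVec_mulVec, Matrix.dotProduct_mulVec v.ofLp, ← Matrix.mulVec_transpose, h1]

/-- The entrywise expectation of a random matrix. -/
noncomputable def matrixMean {Ω : Type*} [MeasurableSpace Ω] {d : ℕ} (μ : Measure Ω)
    (M : Ω → Matrix (Fin d) (Fin d) ℝ) : Matrix (Fin d) (Fin d) ℝ :=
  Matrix.of fun i j => ∫ ω, M ω i j ∂μ

/-- A random matrix has an expectation when all its entries are integrable. -/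
def MatrixIntegrable {Ω : Type*} [MeasurableSpace Ω] {d : ℕ} (μ : Measure Ω)
    (M : Ω → Matrix (Fin d) (Fin d) ℝ) : Prop :=
  ∀ i j, Integrable (fun ω => M ω i j) μ

/-- The Hessian matrix `H = E(x xᵀ)`. -/
noncomputable def hessian {Ω : Type*} [MeasurableSpace Ω] {d : ℕ} (μ : Measure Ω)
    (x : Ω → Vec d) : Matrix (Fin d) (Fin d) ℝ :=
  matrixMean μ fun ω => outer (x ω)

/-- The normal equation `H θ = E(y x)`. -/
def NormalEquation {Ω : Type*} [MeasurableSpace Ω] {d : ℕ} (μ : Measure Ω)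
    (x : Ω → Vec d) (y : Ω → ℝ) (θ : Vec d) : Prop :=
  Matrix.toEuclideanLin (hessian μ x) θ = ∫ ω, y ω • x ω ∂μ

/-- The moment assumption: `σ, R > 0`, the matrices `E((y - xᵀθ*)² x xᵀ)` and `E(‖x‖² x xᵀ)` are
well defined, and they are bounded by `σ² H` and `R² H` in the positive semi-definite order. -/
structure MomentAssumption {Ω : Type*} [MeasurableSpace Ω] {d : ℕ} (μ : Measure Ω)
    (x : Ω → Vec d) (y : Ω → ℝ) (θstar : Vec d) (σ R : ℝ) : Prop where
  sigma_pos : 0 < σ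
  R_pos : 0 < R
  integrable_noise :
    MatrixIntegrable μ fun ω => (y ω - inner ℝ (x ω) θstar) ^ 2 • outer (x ω)
  noise_le :
    (σ ^ 2 • hessian μ x -
      matrixMean μ fun ω => (y ω - inner ℝ (x ω) θstar) ^ 2 • outer (x ω)).PosSemidef
  integrable_fourth : MatrixIntegrable μ fun ω => ‖x ω‖ ^ 2 • outer (x ω)
  fourth_le :
    (R ^ 2 • hessian μ x - matrixMean μ fun ω => ‖x ω‖ ^ 2 • outer (x ω)).PosSemidef

/-- Stochastic gradient descent started from `θ0` at time `m`, after `n` steps, i.e. `θ_{m:m+n}`,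
along a deterministic data sequence `(x_t, y_t)`, `t ∈ ℤ`. -/
noncomputable def sgdSteps {d : ℕ} (γ : ℝ) (θ0 : Vec d) (x : ℤ → Vec d) (y : ℤ → ℝ) (m : ℤ) :
    ℕ → Vec d
  | 0 => θ0
  | n + 1 =>
      sgdSteps γ θ0 x y m n -
        (γ * (inner ℝ (x (m + n)) (sgdSteps γ θ0 x y m n) - y (m + n))) • x (m + n)

/-- The vector `θ_{m:t}` for `m ≤ t`. -/
noncomputable def sgd {d : ℕ} (γ : ℝ) (θ0 : Vec d) (x : ℤ → Vec d) (y : ℤ → ℝ) (m t : ℤ) :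
    Vec d :=
  sgdSteps γ θ0 x y m (t - m).toNat

theorem sgd_self {d : ℕ} (γ : ℝ) (θ0 : Vec d) (x : ℤ → Vec d) (y : ℤ → ℝ) (m : ℤ) :
    sgd γ θ0 x y m m = θ0 := by
  simp [sgd, sgdSteps]

theorem sgd_succ {d : ℕ} (γ : ℝ) (θ0 : Vec d) (x : ℤ → Vec d) (y : ℤ → ℝ) {m t : ℤ}
    (h : m ≤ t) :
    sgd γ θ0 x y m (t + 1) =
      sgd γ θ0 x y m t - (γ * (inner ℝ (x t) (sgd γ θ0 x y m t) - y t)) • x t := by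
  obtain ⟨n, rfl⟩ := Int.le.dest h
  have h1 : (m + n + 1 - m).toNat = n + 1 := by omega
  have h2 : (m + n - m).toNat = n := by omega
  simp only [sgd, h1, h2, sgdSteps]

/-- The tail average `θ̄_k = (k - s)⁻¹ ∑_{t = s}^{k - 1} θ_t`, where `θ_t = θ_{0:t}`. -/
noncomputable def thetaBar {Ω : Type*} {d : ℕ} (γ : ℝ) (θ0 : Vec d) (x : ℤ → Ω → Vec d)
    (y : ℤ → Ω → ℝ) (s k : ℕ) (ω : Ω) : Vec d :=
  ((k : ℝ) - s)⁻¹ •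
    ∑ t ∈ Finset.Ico s k, sgd γ θ0 (fun i => x i ω) (fun i => y i ω) 0 t

/-- The set of possible values of `τ(k,l)`: `{s, …, k - 1}` for `l = 0`, and
`{k (2^l - 1), …, k (2^(l+1) - 1) - 1}` for `l ≥ 1`. -/
def startRange (s k : ℕ) : ℕ → Finset ℕ
  | 0 => Finset.Ico s k
  | l + 1 => Finset.Ico (k * (2 ^ (l + 1) - 1)) (k * (2 ^ (l + 2) - 1))

/-- The level vectors `f_{k,l} = θ_{-τ(k,l):0}`, with `τ l` standing for `τ(k,l)`. -/
noncomputable def levelVec {Ω : Type*} {d : ℕ} (γ : ℝ) (θ0 : Vec d) (x : ℤ → Ω → Vec d)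
    (y : ℤ → Ω → ℝ) (τ : ℕ → Ω → ℕ) (l : ℕ) (ω : Ω) : Vec d :=
  sgd γ θ0 (fun i => x i ω) (fun i => y i ω) (-(τ l ω : ℤ)) 0

/-- The level probabilities `p_l = 1 / (2^l (l+1)^δ) - 1 / (2^(l+1) (l+2)^δ)`. -/
noncomputable def levelProb (δ : ℝ) (l : ℕ) : ℝ :=
  1 / ((2 : ℝ) ^ l * ((l : ℝ) + 1) ^ δ) - 1 / ((2 : ℝ) ^ (l + 1) * ((l : ℝ) + 2) ^ δ)

/-- The single term estimator `Z_k = (f_{k,N+1} - f_{k,N}) / p_N`. -/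
noncomputable def singleTerm {Ω : Type*} {d : ℕ} (γ δ : ℝ) (θ0 : Vec d) (x : ℤ → Ω → Vec d)
    (y : ℤ → Ω → ℝ) (τ : ℕ → Ω → ℕ) (N : Ω → ℕ) (ω : Ω) : Vec d :=
  (levelProb δ (N ω))⁻¹ •
    (levelVec γ θ0 x y τ (N ω + 1) ω - levelVec γ θ0 x y τ (N ω) ω)

/-- The estimator `n'⁻¹ ∑_j (Zᵀ x^(j)) (Z̃ᵀ x^(j))`. -/
noncomputable def sqBiasEstimator {Ω : Type*} {d n' : ℕ} (Z Z' : Ω → Vec d)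
    (X : Fin n' → Ω → Vec d) (ω : Ω) : ℝ :=
  (n' : ℝ)⁻¹ * ∑ j, inner ℝ (Z ω) (X j ω) * inner ℝ (Z' ω) (X j ω)

/-! The mean of `θ_{m:m+n}` is `θ* + (1 - γH)^n (θ0 - θ*)`, which depends only on the number `n` of
steps (`IsIIDData.integral_sgdSteps`). Hence starting at the random time `-τ_0` and stopping at `0`
gives the same mean as `θ̄_k`, and the mean of `f_{k,l}` tends to `θ*` because `τ_l ≥ l`. Averaging
over the independent level `N` cancels each `p_l` and leaves a telescoping series, so `E(Z_k) = θ* -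
E(θ̄_k)` (`integral_singleTerm`). Finally, `Z_k`, its copy and `x^(j)` are independent, so the
expectation of the product factors into the quadratic form of `H` at `E(Z_k)`
(`integral_sqBiasEstimator`).

The analytic point is the integrability of `Z_k`, which amounts to `∑ E‖f_{k,l+1} - f_{k,l}‖ < ∞`.
The trajectories started at `-j-1` and `-j` share all data from time `-j` on, so the noise cancels
in their difference, which follows the noiseless recursion. Each noiseless step contracts in `L¹` by
a factor `r < 1` (`exists_lintegral_step_le`). First moments suffice: no second moment of `Z_k` is
needed, and of the `p_l` only positivity matters besides their being the law of `N`. -/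

/-! ### Coercivity of the Hessian and contraction of one noiseless step -/

theorem Matrix.PosDef.exists_coercive {d : ℕ} {H : Matrix (Fin d) (Fin d) ℝ} (hH : H.PosDef) :
    ∃ c : ℝ, 0 < c ∧ ∀ v : Vec d, c * ‖v‖ ^ 2 ≤ v.ofLp ⬝ᵥ (H *ᵥ v.ofLp) := by
  have hcont : Continuous fun v : Vec d => v.ofLp ⬝ᵥ (H *ᵥ v.ofLp) := by fun_prop
  rcases (Metric.sphere (0 : Vec d) 1).eq_empty_or_nonempty with hs | hs
  -- The unit sphere is empty only in dimension zero; otherwise the constant is the minimum of the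
  -- form on the sphere.
  · refine ⟨1, one_pos, fun v => ?_⟩
    have hv : v = 0 := by
      by_contra h
      have : ‖v‖⁻¹ • v ∈ Metric.sphere (0 : Vec d) 1 := by
        simp [norm_smul, h]
      simp [hs] at this
    simp [hv]
  · obtain ⟨u, hu, hmin⟩ := (isCompact_sphere (0 : Vec d) 1).exists_isMinOn hs hcont.continuousOn
    have hu0 : u.ofLp ≠ 0 := by
      intro h
      have : u = 0 := by ext i; simp [h]
      simp [this] at hu
    refine ⟨u.ofLp ⬝ᵥ (H *ᵥ u.ofLp), by simpa using hH.dotProduct_mulVec_pos hu0, fun v => ?_⟩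
    by_cases h : v = 0
    · simp [h]
    have hv : ‖v‖⁻¹ • v ∈ Metric.sphere (0 : Vec d) 1 := by simp [norm_smul, h]
    have h1 := isMinOn_iff.mp hmin _ hv
    have hn : 0 < ‖v‖ := norm_pos_iff.mpr h
    simp only [WithLp.ofLp_smul, Matrix.mulVec_smul, dotProduct_smul, smul_dotProduct,
      smul_eq_mul] at h1
    calc u.ofLp ⬝ᵥ (H *ᵥ u.ofLp) * ‖v‖ ^ 2
        ≤ (‖v‖⁻¹ * (‖v‖⁻¹ * (v.ofLp ⬝ᵥ (H *ᵥ v.ofLp)))) * ‖v‖ ^ 2 := by gcongr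
      _ = _ := by field_simp

theorem dotProduct_outer_mulVec {d : ℕ} (u v w : Vec d) :
    v.ofLp ⬝ᵥ (outer u *ᵥ w.ofLp) = inner ℝ u v * inner ℝ u w := by
  simp only [PiLp.inner_apply, dotProduct, Matrix.mulVec, outer, Matrix.of_apply, Finset.sum_mul,
    Finset.mul_sum, RCLike.inner_apply, conj_trivial]
  rw [Finset.sum_comm]
  exact Finset.sum_congr rfl fun i _ => Finset.sum_congr rfl fun j _ => by ring

section

variable {Ω : Type*} [MeasurableSpace Ω] {μ : Measure Ω} {d : ℕ}

theorem MatrixIntegrable.integrable_dotProduct {M : Ω → Matrix (Fin d) (Fin d) ℝ}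
    (hM : MatrixIntegrable μ M) (v w : Fin d → ℝ) :
    Integrable (fun ω => v ⬝ᵥ (M ω *ᵥ w)) μ := by
  simp only [dotProduct, Matrix.mulVec]
  exact integrable_finsetSum _ fun i _ => (integrable_finsetSum _ fun j _ =>
    (hM i j).mul_const _).const_mul _

theorem MatrixIntegrable.integral_dotProduct {M : Ω → Matrix (Fin d) (Fin d) ℝ}
    (hM : MatrixIntegrable μ M) (v w : Fin d → ℝ) :
    ∫ ω, v ⬝ᵥ (M ω *ᵥ w) ∂μ = v ⬝ᵥ (matrixMean μ M *ᵥ w) := by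
  simp only [dotProduct, Matrix.mulVec, matrixMean, Matrix.of_apply]
  rw [integral_finsetSum _ fun i _ => (integrable_finsetSum _ fun j _ =>
    (hM i j).mul_const _).const_mul _]
  refine Finset.sum_congr rfl fun i _ => ?_
  rw [integral_const_mul, integral_finsetSum _ fun j _ => (hM i j).mul_const _]
  simp only [integral_mul_const]

theorem matrixIntegrable_outer {x : Ω → Vec d} (hx : MemLp x 2 μ) :
    MatrixIntegrable μ fun ω => outer (x ω) := by
  have h : ∀ i, MemLp (fun ω => x ω i) 2 μ := fun i =>
    (EuclideanSpace.proj (𝕜 := ℝ) i).comp_memLp' hx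
  exact fun i j => (h i).integrable_mul (h j)

/-- One step of noiseless stochastic gradient descent contracts in mean. -/
theorem exists_lintegral_step_le [IsProbabilityMeasure μ] {x : Ω → Vec d} (hx : MemLp x 2 μ)
    (hH : (hessian μ x).PosDef) {R γ : ℝ} (hR : 0 < R)
    (h4 : MatrixIntegrable μ fun ω => ‖x ω‖ ^ 2 • outer (x ω))
    (h4' : (R ^ 2 • hessian μ x - matrixMean μ fun ω => ‖x ω‖ ^ 2 • outer (x ω)).PosSemidef)
    (hγ : 0 < γ) (hγ' : γ < 2 / R ^ 2) :
    ∃ r : ℝ, 0 ≤ r ∧ r < 1 ∧ ∀ v : Vec d,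
      ∫⁻ ω, ‖v - (γ * inner ℝ (x ω) v) • x ω‖ₑ ∂μ ≤ ENNReal.ofReal r * ‖v‖ₑ := by
  obtain ⟨c, hc, hcv⟩ := hH.exists_coercive
  have hgap : 0 < γ * (2 - γ * R ^ 2) := by
    have : γ * R ^ 2 < 2 := (lt_div_iff₀ (by positivity)).mp hγ'
    exact mul_pos hγ (by linarith)
  -- The mean square contracts by `1 - γ(2 - γR²)c`; passing to the first moment halves the gain.
  -- The maximum with `0` only makes the rate nonnegative.
  refine ⟨max 0 (1 - γ * (2 - γ * R ^ 2) * c / 2), le_max_left _ _,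
    max_lt one_pos (by nlinarith [mul_pos hgap hc]), fun v => ?_⟩
  by_cases hv : v = 0
  · simp [hv]
  have hn : 0 < ‖v‖ := norm_pos_iff.mpr hv
  set q := v.ofLp ⬝ᵥ (hessian μ x *ᵥ v.ofLp) with hq
  have hi2 := (matrixIntegrable_outer hx).integrable_dotProduct v.ofLp v.ofLp
  have he2 := (matrixIntegrable_outer hx).integral_dotProduct v.ofLp v.ofLp
  have hi4 := h4.integrable_dotProduct v.ofLp v.ofLp
  have he4 := h4.integral_dotProduct v.ofLp v.ofLp
  have hle := h4'.dotProduct_mulVec_nonneg v.ofLp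
  simp only [star_trivial, Matrix.sub_mulVec, Matrix.smul_mulVec, dotProduct_sub,
    dotProduct_smul, smul_eq_mul, ← he4, dotProduct_outer_mulVec] at hle hi4 hi2
  change _ = q at he2
  simp only [dotProduct_outer_mulVec] at he2
  have hsq : ∀ ω, ‖v - (γ * inner ℝ (x ω) v) • x ω‖ ^ 2 = ‖v‖ ^ 2
      - 2 * γ * (inner ℝ (x ω) v * inner ℝ (x ω) v)
      + γ ^ 2 * (‖x ω‖ ^ 2 * (inner ℝ (x ω) v * inner ℝ (x ω) v)) := fun ω => by
    rw [norm_sub_sq_real, norm_smul, inner_smul_right, real_inner_comm (x ω) v, mul_pow,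
      Real.norm_eq_abs, sq_abs]
    ring
  have hi02 : Integrable (fun ω => ‖v‖ ^ 2 - 2 * γ * (inner ℝ (x ω) v * inner ℝ (x ω) v)) μ :=
    (integrable_const _).sub (hi2.const_mul _)
  have hint : Integrable (fun ω => ‖v - (γ * inner ℝ (x ω) v) • x ω‖ ^ 2) μ := by
    simp only [hsq]
    exact hi02.add (hi4.const_mul _)
  have hval : ∫ ω, ‖v - (γ * inner ℝ (x ω) v) • x ω‖ ^ 2 ∂μ ≤
      ‖v‖ ^ 2 - γ * (2 - γ * R ^ 2) * c * ‖v‖ ^ 2 := by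
    simp only [hsq]
    rw [integral_add hi02 (hi4.const_mul _),
      integral_sub (integrable_const _) (hi2.const_mul _), integral_const_mul, integral_const_mul,
      he2]
    simp only [integral_const, probReal_univ, one_smul]
    have h1 := mul_le_mul_of_nonneg_left (hcv v) hgap.le
    have h2 := mul_le_mul_of_nonneg_left hle (sq_nonneg γ)
    simp only [← hq] at h1 h2
    linarith
  -- AM-GM with weight `‖v‖` turns the second-moment bound into a first-moment bound without square
  -- roots.
  have hbound : ∀ ω, ‖v - (γ * inner ℝ (x ω) v) • x ω‖ ≤
      (‖v - (γ * inner ℝ (x ω) v) • x ω‖ ^ 2 + ‖v‖ ^ 2) / (2 * ‖v‖) := fun ω => by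
    rw [le_div_iff₀ (by positivity)]
    nlinarith [sq_nonneg (‖v - (γ * inner ℝ (x ω) v) • x ω‖ - ‖v‖)]
  have hint' := (hint.add (integrable_const (‖v‖ ^ 2))).div_const (2 * ‖v‖)
  calc ∫⁻ ω, ‖v - (γ * inner ℝ (x ω) v) • x ω‖ₑ ∂μ
      ≤ ∫⁻ ω, ENNReal.ofReal
          ((‖v - (γ * inner ℝ (x ω) v) • x ω‖ ^ 2 + ‖v‖ ^ 2) / (2 * ‖v‖)) ∂μ :=
        lintegral_mono fun ω => by
          rw [← ofReal_norm]; exact ENNReal.ofReal_le_ofReal (hbound ω)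
    _ = ENNReal.ofReal (∫ ω,
          ((‖v - (γ * inner ℝ (x ω) v) • x ω‖ ^ 2 + ‖v‖ ^ 2) / (2 * ‖v‖)) ∂μ) :=
        (ofReal_integral_eq_lintegral_ofReal hint'
          (Filter.Eventually.of_forall fun ω =>
            div_nonneg (add_nonneg (sq_nonneg _) (sq_nonneg _)) (by positivity))).symm
    _ ≤ ENNReal.ofReal ((1 - γ * (2 - γ * R ^ 2) * c / 2) * ‖v‖) := by
        refine ENNReal.ofReal_le_ofReal ?_
        rw [integral_div, integral_add hint (integrable_const _), div_le_iff₀ (by positivity)]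
        simp only [integral_const, probReal_univ, one_smul]
        nlinarith
    _ ≤ ENNReal.ofReal (max 0 (1 - γ * (2 - γ * R ^ 2) * c / 2)) * ‖v‖ₑ := by
        rw [← ofReal_norm, ← ENNReal.ofReal_mul (le_max_left _ _)]
        exact ENNReal.ofReal_le_ofReal
          (mul_le_mul_of_nonneg_right (le_max_right _ _) (norm_nonneg _))

end

/-! ### Independence of past and present, and one step from a random vector -/

/-- Measurability is asked only of the data before time `t`, so that the σ-algebra may also be the
one generated by the past; independence of later data follows from that case. -/
theorem measurable_sgdSteps {Ω : Type*} [MeasurableSpace Ω] {d : ℕ} {γ : ℝ} {θ0 : Vec d}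
    {xs : ℤ → Ω → Vec d} {ys : ℤ → Ω → ℝ} {m t : ℤ} (hxs : ∀ i < t, Measurable (xs i))
    (hys : ∀ i < t, Measurable (ys i)) (n : ℕ) (h : m + n ≤ t) :
    Measurable fun ω => sgdSteps γ θ0 (fun i => xs i ω) (fun i => ys i ω) m n := by
  induction n with
  | zero => exact measurable_const
  | succ n ih =>
    have hlt : m + (n : ℤ) < t := by push_cast at h; omega
    have := ih hlt.le
    have hx := hxs _ hlt
    have hy := hys _ hlt
    simp only [sgdSteps]
    fun_prop

/-- Iterates are independent of the data that come later. -/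
theorem ProbabilityTheory.iIndepFun.indepFun_of_measurable_past {Ω β E : Type*}
    [mΩ : MeasurableSpace Ω] [MeasurableSpace β] [MeasurableSpace E] {μ : Measure Ω}
    {z : ℤ → Ω → β} (hz : ∀ t, Measurable (z t)) (hindep : iIndepFun z μ) {t : ℤ} {D : Ω → E}
    (hD : Measurable[⨆ i ∈ Set.Iio t, MeasurableSpace.comap (z i) inferInstance] D) :
    IndepFun D (z t) μ := by
  have h := indep_iSup_of_disjoint (fun i => (hz i).comap_le) hindep
    (S := Set.Iio t) (T := {t}) (by simp)
  rw [iSup_singleton] at h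
  exact indep_of_indep_of_le_left h hD.comap_le

section Step

variable {Ω : Type*} [MeasurableSpace Ω] {μ : Measure Ω} {d : ℕ}

/-- Under independence the joint law is a product, so Tonelli integrates the bound for a fixed
vector against the law of `D`. -/
theorem lintegral_step_le_of_indepFun [IsProbabilityMeasure μ] {D X : Ω → Vec d}
    (hD : Measurable D) (hX : Measurable X) (h : IndepFun D X μ) {γ : ℝ} {c : ENNReal}
    (hc : ∀ v : Vec d, ∫⁻ ω, ‖v - (γ * inner ℝ (X ω) v) • X ω‖ₑ ∂μ ≤ c * ‖v‖ₑ) :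
    ∫⁻ ω, ‖D ω - (γ * inner ℝ (X ω) (D ω)) • X ω‖ₑ ∂μ ≤ c * ∫⁻ ω, ‖D ω‖ₑ ∂μ := by
  have hF : Measurable fun p : Vec d × Vec d => ‖p.1 - (γ * inner ℝ p.2 p.1) • p.2‖ₑ := by
    fun_prop
  have : IsProbabilityMeasure (μ.map X) := Measure.isProbabilityMeasure_map hX.aemeasurable
  calc ∫⁻ ω, ‖D ω - (γ * inner ℝ (X ω) (D ω)) • X ω‖ₑ ∂μ
      = ∫⁻ p, ‖p.1 - (γ * inner ℝ p.2 p.1) • p.2‖ₑ ∂μ.map fun ω => (D ω, X ω) :=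
        (lintegral_map hF (hD.prodMk hX)).symm
    _ = ∫⁻ v, ∫⁻ ω, ‖v - (γ * inner ℝ (X ω) v) • X ω‖ₑ ∂μ ∂μ.map D := by
        rw [h.map_prod_eq_prod_map_map hD.aemeasurable hX.aemeasurable,
          lintegral_prod _ hF.aemeasurable]
        exact lintegral_congr fun v => lintegral_map (hF.comp measurable_prodMk_left) hX
    _ ≤ ∫⁻ v, c * ‖v‖ₑ ∂μ.map D := lintegral_mono hc
    _ = c * ∫⁻ ω, ‖D ω‖ₑ ∂μ := by
        rw [lintegral_const_mul _ measurable_enorm, lintegral_map measurable_enorm hD]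

/-- The operator `v ↦ ⟪u, v⟫ u`. -/
noncomputable def outerCLM (u : Vec d) : Vec d →L[ℝ] Vec d := (innerSL ℝ u).smulRight u

@[simp] theorem outerCLM_apply (u v : Vec d) : outerCLM u v = (inner ℝ u v : ℝ) • u := rfl

theorem continuous_outerCLM : Continuous (outerCLM (d := d)) := by
  have : outerCLM (d := d) =
      fun u => ContinuousLinearMap.smulRightL ℝ (Vec d) (Vec d) (innerSL ℝ u) u := rfl
  rw [this]
  fun_prop

theorem integrable_outerCLM {x : Ω → Vec d} (hx : MemLp x 2 μ) :
    Integrable (fun ω => outerCLM (x ω)) μ := by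
  refine (hx.integrable_norm_pow two_ne_zero).mono'
    (continuous_outerCLM.comp_aestronglyMeasurable hx.1) (.of_forall fun ω => ?_)
  simp [outerCLM, sq]

theorem integral_outerCLM_apply {x : Ω → Vec d} (hx : MemLp x 2 μ) (v : Vec d) :
    (∫ ω, outerCLM (x ω) ∂μ) v = ∫ ω, (inner ℝ (x ω) v : ℝ) • x ω ∂μ := by
  rw [ContinuousLinearMap.integral_apply (integrable_outerCLM hx)]
  rfl

theorem integral_outerCLM_eq_hessian {x : Ω → Vec d} (hx : MemLp x 2 μ) (v : Vec d) :
    (∫ ω, outerCLM (x ω) ∂μ) v = Matrix.toEuclideanLin (hessian μ x) v := by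
  have hint : Integrable (fun ω => (inner ℝ (x ω) v : ℝ) • x ω) μ :=
    (integrable_outerCLM hx).apply_continuousLinearMap v
  refine ext_inner_left ℝ fun w => ?_
  rw [integral_outerCLM_apply hx, ← integral_inner hint, EuclideanSpace.inner_eq_star_dotProduct]
  simp only [star_trivial, Matrix.ofLp_toLpLin, Matrix.toLin'_apply, inner_smul_right]
  rw [dotProduct_comm]
  unfold hessian
  rw [← (matrixIntegrable_outer hx).integral_dotProduct]
  refine integral_congr_ae (.of_forall fun ω => ?_)
  simp only [dotProduct_outer_mulVec, real_inner_comm w]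
  ring

/-- Independence, rather than Hölder, makes the random operator applied to `D` integrable: `D` needs
only a first moment, and no moment of `X` beyond the second is used. -/
theorem integrable_step_of_indepFun {D X : Ω → Vec d} {Y : Ω → ℝ} (hD : Integrable D μ)
    (hX : MemLp X 2 μ) (hY : MemLp Y 2 μ) (h : IndepFun D X μ) (γ : ℝ) :
    Integrable (fun ω => D ω - (γ * (inner ℝ (X ω) (D ω) - Y ω)) • X ω) μ ∧
      ∫ ω, (D ω - (γ * (inner ℝ (X ω) (D ω) - Y ω)) • X ω) ∂μ =
        ∫ ω, D ω ∂μ - γ • ((∫ ω, outerCLM (X ω) ∂μ) (∫ ω, D ω ∂μ) - ∫ ω, Y ω • X ω ∂μ) := by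
  have hAD : IndepFun (fun ω => outerCLM (X ω)) D μ :=
    h.symm.comp continuous_outerCLM.measurable measurable_id
  have hA := integrable_outerCLM hX
  have h1 : Integrable (fun ω => outerCLM (X ω) (D ω)) μ :=
    hAD.integrable_bilin hA hD (ContinuousLinearMap.id ℝ (Vec d →L[ℝ] Vec d))
  have h2 : ∫ ω, outerCLM (X ω) (D ω) ∂μ = (∫ ω, outerCLM (X ω) ∂μ) (∫ ω, D ω ∂μ) :=
    hAD.integral_bilin hA hD (ContinuousLinearMap.id ℝ (Vec d →L[ℝ] Vec d))
  have h3 : Integrable (fun ω => Y ω • X ω) μ :=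
    memLp_one_iff_integrable.mp (hX.smul hY)
  have heq : (fun ω => D ω - (γ * (inner ℝ (X ω) (D ω) - Y ω)) • X ω) =
      fun ω => D ω - γ • (outerCLM (X ω) (D ω) - Y ω • X ω) := by
    ext1 ω
    rw [outerCLM_apply, ← sub_smul, smul_smul]
  have h4 : Integrable (fun ω => γ • (outerCLM (X ω) (D ω) - Y ω • X ω)) μ := (h1.sub h3).smul γ
  rw [heq]
  exact ⟨hD.sub h4, by rw [integral_sub hD h4, integral_smul, integral_sub h1 h3, h2]⟩

end Step

/-! ### Mixtures over a random index -/

/-- A random variable with a random index: if `N` is independent of each `G l`, the mean of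
`G N` is the mixture of the means. -/
theorem integrable_randomIndex {Ω E : Type*} [MeasurableSpace Ω] {μ : Measure Ω}
    [IsProbabilityMeasure μ] [NormedAddCommGroup E] [NormedSpace ℝ E] [CompleteSpace E]
    [MeasurableSpace E] [BorelSpace E] [SecondCountableTopology E] {N : Ω → ℕ} {G : ℕ → Ω → E}
    (hN : Measurable N) (hG : ∀ l, Measurable (G l)) (hind : ∀ l, IndepFun N (G l) μ)
    (hsum : ∑' l, μ {ω | N ω = l} * ∫⁻ ω, ‖G l ω‖ₑ ∂μ ≠ ⊤) :
    Integrable (fun ω => G (N ω) ω) μ ∧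
      HasSum (fun l => μ.real {ω | N ω = l} • ∫ ω, G l ω ∂μ) (∫ ω, G (N ω) ω ∂μ) := by
  have hs : ∀ l, MeasurableSet {ω | N ω = l} := fun l => hN (measurableSet_singleton l)
  have hd : Pairwise (Function.onFun Disjoint fun l => {ω | N ω = l}) := fun i j hij =>
    Set.disjoint_left.mpr fun ω hi hj => hij (hi.symm.trans hj)
  have hU : ⋃ l, {ω | N ω = l} = Set.univ := by ext; simp
  have hmeas : Measurable fun ω => G (N ω) ω :=
    (measurable_from_prod_countable_right hG : Measurable fun p : ℕ × Ω => G p.1 p.2).comp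
      (hN.prodMk measurable_id)
  have hint : Integrable (fun ω => G (N ω) ω) μ := by
    refine ⟨hmeas.aestronglyMeasurable, ?_⟩
    rw [HasFiniteIntegral, ← setLIntegral_univ, ← hU, lintegral_iUnion hs hd]
    refine lt_of_le_of_lt (ENNReal.tsum_le_tsum fun l => ?_) hsum.lt_top
    rw [setLIntegral_congr_fun (g := fun ω => ‖G l ω‖ₑ) (hs l)
      fun ω (hω : N ω = l) => by simp only [hω]]
    have h1 : IndepFun (fun ω => ({l} : Set ℕ).indicator (fun _ => (1 : ENNReal)) (N ω))
        (fun ω => ‖G l ω‖ₑ) μ :=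
      (hind l).comp (measurable_const.indicator (measurableSet_singleton l)) measurable_enorm
    have h2 := lintegral_mul_eq_lintegral_mul_lintegral_of_indepFun''
      ((measurable_const.indicator (measurableSet_singleton l)).comp hN).aemeasurable
      (hG l).enorm.aemeasurable h1
    have h3 : (fun ω => ({l} : Set ℕ).indicator (fun _ => (1 : ENNReal)) (N ω)) =
        Set.indicator {ω | N ω = l} 1 := rfl
    simp only [Function.comp_def] at h2
    rw [h3, lintegral_indicator_one (hs l)] at h2
    rw [← h2, ← lintegral_indicator (hs l)]
    refine lintegral_mono fun ω => ?_
    by_cases hω : N ω = l <;> simp [Set.indicator, hω]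
  refine ⟨hint, ?_⟩
  have := hasSum_integral_iUnion hs hd hint.integrableOn
  rw [hU, setIntegral_univ] at this
  convert this using 2 with l
  rw [setIntegral_congr_fun (g := G l) (hs l) fun ω (hω : N ω = l) => by simp only [hω]]
  have h1 : IndepFun (fun ω => ({l} : Set ℕ).indicator (fun _ => (1 : ℝ)) (N ω)) (G l) μ :=
    (hind l).comp (measurable_const.indicator (measurableSet_singleton l)) measurable_id
  have h2 := h1.integral_fun_smul_eq_smul_integral
    ((measurable_const.indicator (measurableSet_singleton l)).comp hN).aestronglyMeasurable
    (hG l).aestronglyMeasurable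
  have h3 : (fun ω => ({l} : Set ℕ).indicator (fun _ => (1 : ℝ)) (N ω)) =
      Set.indicator {ω | N ω = l} 1 := rfl
  rw [h3, integral_indicator_one (hs l)] at h2
  rw [← h2, ← integral_indicator (hs l)]
  refine integral_congr_ae (.of_forall fun ω => ?_)
  by_cases hω : N ω = l <;> simp [Set.indicator, hω]

/-! ### Iterates along i.i.d. data: means and increments -/

/-- `(x_t, y_t)`, `t ∈ ℤ`, are independent measurable copies of the square-integrable `(x, y)`. -/
structure IsIIDData {Ω₀ Ω : Type*} [MeasurableSpace Ω₀] [MeasurableSpace Ω] (μ₀ : Measure Ω₀)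
    (μ : Measure Ω) {d : ℕ} (x : Ω₀ → Vec d) (y : Ω₀ → ℝ) (xs : ℤ → Ω → Vec d)
    (ys : ℤ → Ω → ℝ) : Prop where
  memLp_x : MemLp x 2 μ₀
  memLp_y : MemLp y 2 μ₀
  measurable_xs : ∀ t, Measurable (xs t)
  measurable_ys : ∀ t, Measurable (ys t)
  copy : ∀ t, IdentDistrib (fun ω => (xs t ω, ys t ω)) (fun ω => (x ω, y ω)) μ μ₀
  indep : iIndepFun (fun t ω => (xs t ω, ys t ω)) μ

/-- The iterate `θ_{-j:0}`. -/
noncomputable def backIterate {Ω : Type*} {d : ℕ} (γ : ℝ) (θ0 : Vec d) (xs : ℤ → Ω → Vec d)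
    (ys : ℤ → Ω → ℝ) (j : ℕ) (ω : Ω) : Vec d :=
  sgd γ θ0 (fun i => xs i ω) (fun i => ys i ω) (-(j : ℤ)) 0

theorem backIterate_eq_sgdSteps {Ω : Type*} {d : ℕ} (γ : ℝ) (θ0 : Vec d) (xs : ℤ → Ω → Vec d)
    (ys : ℤ → Ω → ℝ) (j : ℕ) :
    backIterate γ θ0 xs ys j =
      fun ω => sgdSteps γ θ0 (fun i => xs i ω) (fun i => ys i ω) (-(j : ℤ)) j := by
  ext1 ω
  simp [backIterate, sgd]

theorem measurable_backIterate {Ω : Type*} [MeasurableSpace Ω] {d : ℕ} {γ : ℝ} {θ0 : Vec d}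
    {xs : ℤ → Ω → Vec d} {ys : ℤ → Ω → ℝ} (hxs : ∀ i, Measurable (xs i))
    (hys : ∀ i, Measurable (ys i)) (j : ℕ) : Measurable (backIterate γ θ0 xs ys j) := by
  rw [backIterate_eq_sgdSteps]
  exact measurable_sgdSteps (t := 0) (fun i _ => hxs i) (fun i _ => hys i) j (by simp)

theorem measurable_sgdSteps_past {Ω : Type*} {d : ℕ} {xs : ℤ → Ω → Vec d}
    {ys : ℤ → Ω → ℝ} (t : ℤ) (n : ℕ) (γ : ℝ) (θ0 : Vec d) {m : ℤ}
    (hmn : m + n ≤ t) :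
    Measurable[⨆ i ∈ Set.Iio t, MeasurableSpace.comap (fun ω => (xs i ω, ys i ω)) inferInstance]
      fun ω => sgdSteps γ θ0 (fun i => xs i ω) (fun i => ys i ω) m n := by
  have key : ∀ i < t,
      Measurable[⨆ i ∈ Set.Iio t, MeasurableSpace.comap (fun ω => (xs i ω, ys i ω)) inferInstance]
        fun ω => (xs i ω, ys i ω) := fun i hi =>
    measurable_iff_comap_le.mpr (le_iSup₂_of_le i hi le_rfl)
  exact @measurable_sgdSteps Ω (_) d γ θ0 xs ys m t (fun i hi => measurable_fst.comp (key i hi))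
    (fun i hi => measurable_snd.comp (key i hi)) n hmn

namespace IsIIDData

variable {Ω₀ Ω : Type*} [MeasurableSpace Ω₀] [MeasurableSpace Ω] {μ₀ : Measure Ω₀}
  {μ : Measure Ω} {d : ℕ} {x : Ω₀ → Vec d} {y : Ω₀ → ℝ} {xs : ℤ → Ω → Vec d} {ys : ℤ → Ω → ℝ}

theorem identDistrib_xs (h : IsIIDData μ₀ μ x y xs ys) (t : ℤ) : IdentDistrib (xs t) x μ μ₀ :=
  (h.copy t).comp measurable_fst

theorem memLp_xs (h : IsIIDData μ₀ μ x y xs ys) (t : ℤ) : MemLp (xs t) 2 μ :=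
  (h.identDistrib_xs t).memLp_iff.mpr h.memLp_x

theorem memLp_ys (h : IsIIDData μ₀ μ x y xs ys) (t : ℤ) : MemLp (ys t) 2 μ :=
  ((h.copy t).comp measurable_snd).memLp_iff.mpr h.memLp_y

theorem integral_outerCLM (h : IsIIDData μ₀ μ x y xs ys) (t : ℤ) :
    ∫ ω, outerCLM (xs t ω) ∂μ = ∫ ω, outerCLM (x ω) ∂μ₀ :=
  ((h.identDistrib_xs t).comp continuous_outerCLM.measurable).integral_eq

theorem integral_smul (h : IsIIDData μ₀ μ x y xs ys) (t : ℤ) :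
    ∫ ω, ys t ω • xs t ω ∂μ = ∫ ω, y ω • x ω ∂μ₀ :=
  ((h.copy t).comp (u := fun p : Vec d × ℝ => p.2 • p.1) (by fun_prop)).integral_eq

theorem indepFun_xs (h : IsIIDData μ₀ μ x y xs ys) {t : ℤ} {D : Ω → Vec d}
    (hD : Measurable[⨆ i ∈ Set.Iio t,
      MeasurableSpace.comap (fun ω => (xs i ω, ys i ω)) inferInstance] D) :
    IndepFun D (xs t) μ :=
  (h.indep.indepFun_of_measurable_past
    (fun t => (h.measurable_xs t).prodMk (h.measurable_ys t)) hD).comp measurable_id measurable_fst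

/-- The mean of an iterate depends only on the number of steps. -/
theorem integral_sgdSteps [IsProbabilityMeasure μ] (h : IsIIDData μ₀ μ x y xs ys) (γ : ℝ)
    (θ0 θstar : Vec d) (hθ : (∫ ω, outerCLM (x ω) ∂μ₀) θstar = ∫ ω, y ω • x ω ∂μ₀)
    (m : ℤ) (n : ℕ) :
    Integrable (fun ω => sgdSteps γ θ0 (fun i => xs i ω) (fun i => ys i ω) m n) μ ∧
      ∫ ω, sgdSteps γ θ0 (fun i => xs i ω) (fun i => ys i ω) m n ∂μ =
        θstar + ((1 - γ • ∫ ω, outerCLM (x ω) ∂μ₀ : Vec d →L[ℝ] Vec d) ^ n) (θ0 - θstar) := by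
  induction n with
  | zero => exact ⟨integrable_const _, by simp [sgdSteps]⟩
  | succ n ih =>
    obtain ⟨h1, h2⟩ := integrable_step_of_indepFun ih.1 (h.memLp_xs (m + n)) (h.memLp_ys (m + n))
      (h.indepFun_xs (measurable_sgdSteps_past (m + n) n γ θ0 le_rfl)) γ
    refine ⟨h1, h2.trans ?_⟩
    -- The normal equation replaces `E(yx)` by `Hθ*`, so one step multiplies the mean error by `1 -
    -- γH`.
    rw [h.integral_outerCLM, h.integral_smul, ih.2, ← hθ, pow_succ']
    simp only [map_add, mul_apply_eq_comp, sub_apply,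
      one_apply_eq_self, smul_apply]
    module

/-- The increments `θ_{-j-1:0} - θ_{-j:0}` are small in mean. -/
theorem lintegral_backIterate_succ_sub_le [IsProbabilityMeasure μ]
    (h : IsIIDData μ₀ μ x y xs ys) {γ : ℝ} {c : ENNReal}
    (hc : ∀ v : Vec d, ∫⁻ ω, ‖v - (γ * inner ℝ (x ω) v) • x ω‖ₑ ∂μ₀ ≤ c * ‖v‖ₑ)
    (θ0 : Vec d) (j : ℕ) :
    ∫⁻ ω, ‖backIterate γ θ0 xs ys (j + 1) ω - backIterate γ θ0 xs ys j ω‖ₑ ∂μ ≤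
      (∫⁻ ω, ‖(γ * (inner ℝ (x ω) θ0 - y ω)) • x ω‖ₑ ∂μ₀) * c ^ j := by
  have key : ∀ (m : ℤ) (n : ℕ),
      ∫⁻ ω, ‖sgdSteps γ θ0 (fun i => xs i ω) (fun i => ys i ω) m (n + 1) -
          sgdSteps γ θ0 (fun i => xs i ω) (fun i => ys i ω) (m + 1) n‖ₑ ∂μ ≤
        (∫⁻ ω, ‖(γ * (inner ℝ (x ω) θ0 - y ω)) • x ω‖ₑ ∂μ₀) * c ^ n := by
    intro m n
    induction n with
    | zero =>
      have h1 := ((h.copy m).comp (u := fun p : Vec d × ℝ =>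
        ‖(γ * (inner ℝ p.1 θ0 - p.2)) • p.1‖ₑ) (by fun_prop)).lintegral_eq
      refine le_of_eq ?_
      simpa [sgdSteps, Function.comp_def] using h1
    | succ n ih =>
      have hidx : m + 1 + (n : ℤ) = m + ((n + 1 : ℕ) : ℤ) := by push_cast; ring
      set D : Ω → Vec d := fun ω => sgdSteps γ θ0 (fun i => xs i ω) (fun i => ys i ω) m (n + 1) -
          sgdSteps γ θ0 (fun i => xs i ω) (fun i => ys i ω) (m + 1) n with hD
      have hDm : Measurable D :=
        (measurable_sgdSteps (t := m + (n + 1 : ℕ)) (fun i _ => h.measurable_xs i)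
          (fun i _ => h.measurable_ys i) _ le_rfl).sub
        (measurable_sgdSteps (t := m + 1 + n) (fun i _ => h.measurable_xs i)
          (fun i _ => h.measurable_ys i) _ le_rfl)
      have hind : IndepFun D (xs (m + (n + 1 : ℕ))) μ :=
        h.indepFun_xs ((measurable_sgdSteps_past _ _ γ θ0 le_rfl).sub
          (measurable_sgdSteps_past _ _ γ θ0 hidx.le))
      have hc' : ∀ v : Vec d, ∫⁻ ω, ‖v - (γ * inner ℝ (xs (m + (n + 1 : ℕ)) ω) v) •
          xs (m + (n + 1 : ℕ)) ω‖ₑ ∂μ ≤ c * ‖v‖ₑ := fun v =>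
        le_of_eq_of_le ((h.identDistrib_xs _).comp
          (u := fun u : Vec d => ‖v - (γ * inner ℝ u v) • u‖ₑ) (by fun_prop)).lintegral_eq (hc v)
      have hstep := lintegral_step_le_of_indepFun hDm (h.measurable_xs _) hind hc'
      -- Both trajectories are now at time `m + n + 1` and use the same data point, so `y` drops out
      -- of their difference.
      calc _ = ∫⁻ ω, ‖D ω - (γ * inner ℝ (xs (m + (n + 1 : ℕ)) ω) (D ω)) •
              xs (m + (n + 1 : ℕ)) ω‖ₑ ∂μ := by
            refine lintegral_congr fun ω => congrArg _ ?_
            rw [sgdSteps, sgdSteps.eq_2 _ _ _ _ (m + 1) n, hidx, hD]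
            simp only [inner_sub_right]
            module
        _ ≤ c * ∫⁻ ω, ‖D ω‖ₑ ∂μ := hstep
        _ ≤ c * ((∫⁻ ω, ‖(γ * (inner ℝ (x ω) θ0 - y ω)) • x ω‖ₑ ∂μ₀) * c ^ n) := by gcongr
        _ = _ := by ring
  have := key (-((j + 1 : ℕ) : ℤ)) j
  rw [show -((j + 1 : ℕ) : ℤ) + 1 = -(j : ℤ) by push_cast; ring] at this
  rw [backIterate_eq_sgdSteps, backIterate_eq_sgdSteps]
  exact this

end IsIIDData

/-! ### Random starting times and bounds for the levels -/

/-- The bound is uniform in `a, b ≥ l`, so it survives the substitution of random indices. -/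
theorem edist_le_tsum_edist_succ {E : Type*} [PseudoEMetricSpace E] (g : ℕ → E) {l a b : ℕ}
    (ha : l ≤ a) (hb : l ≤ b) : edist (g a) (g b) ≤ ∑' j, edist (g (l + j)) (g (l + j + 1)) := by
  wlog hab : a ≤ b generalizing a b
  · rw [edist_comm]
    exact this hb ha (le_of_not_ge hab)
  calc edist (g a) (g b) ≤ ∑ i ∈ Finset.Ico a b, edist (g i) (g (i + 1)) :=
        edist_le_Ico_sum_edist g hab
    _ ≤ ∑ i ∈ Finset.Ico l b, edist (g i) (g (i + 1)) :=
        Finset.sum_le_sum_of_subset (Finset.Ico_subset_Ico_left ha)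
    _ = ∑ j ∈ Finset.range (b - l), edist (g (l + j)) (g (l + j + 1)) :=
        Finset.sum_Ico_eq_sum_range _ _ _
    _ ≤ _ := ENNReal.sum_le_tsum _

theorem levelProb_pos {δ : ℝ} (hδ : 1 < δ) (l : ℕ) : 0 < levelProb δ l := by
  rw [levelProb, sub_pos]
  have h1 : ((l : ℝ) + 1) ^ δ ≤ ((l : ℝ) + 2) ^ δ :=
    Real.rpow_le_rpow (by positivity) (by linarith) (by linarith)
  have h2 : 0 < ((l : ℝ) + 1) ^ δ := Real.rpow_pos_of_pos (by positivity) _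
  refine one_div_lt_one_div_of_lt (by positivity) ?_
  exact mul_lt_mul (pow_lt_pow_right₀ one_lt_two (Nat.lt_succ_self l)) h1 h2 (by positivity)

theorem le_of_mem_startRange {s k l n : ℕ} (hk : 2 ≤ k) (hn : n ∈ startRange s k l) : l ≤ n := by
  cases l with
  | zero => exact Nat.zero_le n
  | succ l =>
    simp only [startRange, Finset.mem_Ico] at hn
    have h1 : l + 1 < 2 ^ (l + 1) := Nat.lt_two_pow_self
    have h2 : 1 * (2 ^ (l + 1) - 1) ≤ k * (2 ^ (l + 1) - 1) := by gcongr; omega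
    omega

/-- Since `k ≥ 2`, `αk ≤ k/2 ≤ k - 1`; the averaging window is therefore nonempty. -/
theorem tail_lt {α : ℝ} {k s : ℕ} (hα : α ≤ 1 / 2) (hk : 2 ≤ k) (hs : s ≤ ⌈α * k⌉₊) : s < k := by
  have h1 : s ≤ k - 1 := by
    refine hs.trans (Nat.ceil_le.mpr ?_)
    have : (2 : ℝ) ≤ k := by exact_mod_cast hk
    rw [Nat.cast_sub (by omega)]
    push_cast
    nlinarith
  omega

theorem startRange_nonempty {s k : ℕ} (hs : s < k) (l : ℕ) : (startRange s k l).Nonempty := by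
  cases l with
  | zero => exact Finset.nonempty_Ico.mpr hs
  | succ l =>
    refine Finset.nonempty_Ico.mpr ?_
    have h1 : 2 ^ (l + 1) < 2 ^ (l + 2) := Nat.pow_lt_pow_right one_lt_two (by omega)
    have h2 : 1 ≤ 2 ^ (l + 1) := Nat.one_le_two_pow
    exact Nat.mul_lt_mul_of_pos_left (by omega) (by omega)

theorem measureReal_uniform {Ω : Type*} [MeasurableSpace Ω] {μ : Measure Ω} {τ : Ω → ℕ}
    {S : Finset ℕ} (hτ : HasLaw τ (uniformOn (S : Set ℕ)) μ) (n : ℕ) :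
    μ.real {ω | τ ω = n} = if n ∈ S then (S.card : ℝ)⁻¹ else 0 := by
  rw [measureReal_def, hτ.measure_eq (p := fun i => i = n) (measurableSet_singleton n),
    Set.ofPred_eq_eq_singleton, ← Finset.coe_singleton, uniformOn_apply_finset]
  split_ifs with h
  · simp [Finset.inter_singleton_of_mem h]
  · simp [Finset.inter_singleton_of_notMem h]

namespace IsIIDData

variable {Ω₀ Ω : Type*} [MeasurableSpace Ω₀] [MeasurableSpace Ω] {μ₀ : Measure Ω₀}
  {μ : Measure Ω} [IsProbabilityMeasure μ] {d : ℕ} {x : Ω₀ → Vec d} {y : Ω₀ → ℝ}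
  {xs : ℤ → Ω → Vec d} {ys : ℤ → Ω → ℝ}

/-- The mean of `θ_{-τ:0}` with `τ` uniform on `S` and independent of the data. -/
theorem integral_backIterate_uniform (h : IsIIDData μ₀ μ x y xs ys) (γ : ℝ)
    (θ0 θstar : Vec d) (hθ : (∫ ω, outerCLM (x ω) ∂μ₀) θstar = ∫ ω, y ω • x ω ∂μ₀)
    {τ : Ω → ℕ} {S : Finset ℕ} (hτ : Measurable τ) (hτ_law : HasLaw τ (uniformOn (S : Set ℕ)) μ)
    (hind : ∀ n, IndepFun τ (backIterate γ θ0 xs ys n) μ) :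
    Integrable (fun ω => backIterate γ θ0 xs ys (τ ω) ω) μ ∧
      ∫ ω, backIterate γ θ0 xs ys (τ ω) ω ∂μ = (S.card : ℝ)⁻¹ • ∑ n ∈ S,
        (θstar + ((1 - γ • ∫ ω, outerCLM (x ω) ∂μ₀ : Vec d →L[ℝ] Vec d) ^ n) (θ0 - θstar)) := by
  have hmean := fun n : ℕ => h.integral_sgdSteps γ θ0 θstar hθ (-(n : ℤ)) n
  simp only [← backIterate_eq_sgdSteps γ θ0 xs ys] at hmean
  have hzero : ∀ n ∉ S, μ.real {ω | τ ω = n} = 0 := fun n hn => by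
    rw [measureReal_uniform hτ_law, if_neg hn]
  have hfin : ∑' n, μ {ω | τ ω = n} * ∫⁻ ω, ‖backIterate γ θ0 xs ys n ω‖ₑ ∂μ ≠ ⊤ := by
    rw [tsum_eq_sum (s := S) fun n hn => by
      rw [(measureReal_eq_zero_iff).mp (hzero n hn), zero_mul]]
    exact (ENNReal.sum_lt_top.mpr fun n _ =>
      ENNReal.mul_lt_top (measure_lt_top _ _) (hmean n).1.2).ne
  obtain ⟨h1, h2⟩ := integrable_randomIndex hτ
    (measurable_backIterate (γ := γ) (θ0 := θ0) h.measurable_xs h.measurable_ys) hind hfin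
  have h3 : HasSum (fun l => μ.real {ω | τ ω = l} • ∫ ω, backIterate γ θ0 xs ys l ω ∂μ)
      (∑ l ∈ S, μ.real {ω | τ ω = l} • ∫ ω, backIterate γ θ0 xs ys l ω ∂μ) :=
    hasSum_sum_of_ne_finset_zero fun n hn => by rw [hzero n hn, zero_smul]
  refine ⟨h1, (h2.unique h3).trans ?_⟩
  rw [Finset.smul_sum]
  refine Finset.sum_congr rfl fun n hn => ?_
  rw [measureReal_uniform hτ_law, if_pos hn]
  exact congrArg _ (hmean n).2

/-- The difference is dominated pointwise by the sum of all increments from index `l` on, whose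
means form a geometric series. No independence of `τ₁`, `τ₂` from the data is required. -/
theorem lintegral_backIterate_sub_le (h : IsIIDData μ₀ μ x y xs ys) {γ : ℝ} {c : ENNReal}
    (hc : ∀ v : Vec d, ∫⁻ ω, ‖v - (γ * inner ℝ (x ω) v) • x ω‖ₑ ∂μ₀ ≤ c * ‖v‖ₑ)
    (θ0 : Vec d) {l : ℕ} {τ₁ τ₂ : Ω → ℕ} (h₁ : ∀ᵐ ω ∂μ, l ≤ τ₁ ω) (h₂ : ∀ᵐ ω ∂μ, l ≤ τ₂ ω) :
    ∫⁻ ω, ‖backIterate γ θ0 xs ys (τ₁ ω) ω - backIterate γ θ0 xs ys (τ₂ ω) ω‖ₑ ∂μ ≤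
      (∫⁻ ω, ‖(γ * (inner ℝ (x ω) θ0 - y ω)) • x ω‖ₑ ∂μ₀) * (1 - c)⁻¹ * c ^ l := by
  have hm := measurable_backIterate (γ := γ) (θ0 := θ0) h.measurable_xs h.measurable_ys
  calc _ ≤ ∫⁻ ω, ∑' j, edist (backIterate γ θ0 xs ys (l + j) ω)
            (backIterate γ θ0 xs ys (l + j + 1) ω) ∂μ := by
        refine lintegral_mono_ae ?_
        filter_upwards [h₁, h₂] with ω hω₁ hω₂
        rw [← edist_eq_enorm_sub]
        exact edist_le_tsum_edist_succ (fun n => backIterate γ θ0 xs ys n ω) hω₁ hω₂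
    _ = ∑' j, ∫⁻ ω, ‖backIterate γ θ0 xs ys (l + j + 1) ω - backIterate γ θ0 xs ys (l + j) ω‖ₑ
          ∂μ := by
        rw [lintegral_tsum fun j => ((hm _).edist (hm _)).aemeasurable]
        simp only [edist_comm (backIterate γ θ0 xs ys (l + _) _), edist_eq_enorm_sub]
    _ ≤ ∑' j, (∫⁻ ω, ‖(γ * (inner ℝ (x ω) θ0 - y ω)) • x ω‖ₑ ∂μ₀) * c ^ (l + j) :=
        ENNReal.tsum_le_tsum fun j => h.lintegral_backIterate_succ_sub_le hc θ0 (l + j)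
    _ = _ := by
        simp only [pow_add, ENNReal.tsum_mul_left, ENNReal.tsum_geometric]
        ring

end IsIIDData

theorem norm_pow_apply_le {E : Type*} [NormedAddCommGroup E] [NormedSpace ℝ E] {A : E →L[ℝ] E}
    {r : ℝ} (hr : 0 ≤ r) (hA : ∀ v, ‖A v‖ ≤ r * ‖v‖) (n : ℕ) (v : E) :
    ‖(A ^ n) v‖ ≤ r ^ n * ‖v‖ := by
  induction n with
  | zero => simp
  | succ n ih =>
    rw [pow_succ', mul_apply_eq_comp, pow_succ', mul_assoc]
    exact (hA _).trans (mul_le_mul_of_nonneg_left ih hr)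

theorem norm_average_add_sub_le {E ι : Type*} [NormedAddCommGroup E] [NormedSpace ℝ E]
    {S : Finset ι} (hS : S.Nonempty) (v : E) (e : ι → E) {C : ℝ} (hC : ∀ i ∈ S, ‖e i‖ ≤ C) :
    ‖(S.card : ℝ)⁻¹ • ∑ i ∈ S, (v + e i) - v‖ ≤ C := by
  have hcard : (0 : ℝ) < S.card := by exact_mod_cast hS.card_pos
  have h1 : (S.card : ℝ)⁻¹ • ∑ i ∈ S, (v + e i) - v = (S.card : ℝ)⁻¹ • ∑ i ∈ S, e i := by
    rw [Finset.sum_add_distrib, Finset.sum_const, smul_add, ← Nat.cast_smul_eq_nsmul ℝ, smul_smul,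
      inv_mul_cancel₀ hcard.ne', one_smul, add_sub_cancel_left]
  rw [h1, norm_smul, norm_inv, Real.norm_natCast, inv_mul_le_iff₀ hcard]
  simpa using norm_sum_le_of_le S hC

/-- The norm of a mean is at most the mean of the norm, so the `L¹` contraction passes to `1 - γH`
with no spectral argument. -/
theorem norm_one_sub_integral_outerCLM_le {Ω : Type*} [MeasurableSpace Ω] {μ : Measure Ω}
    [IsProbabilityMeasure μ] {d : ℕ} {x : Ω → Vec d} (hx : MemLp x 2 μ) {γ r : ℝ} (hr : 0 ≤ r)
    (hc : ∀ v : Vec d, ∫⁻ ω, ‖v - (γ * inner ℝ (x ω) v) • x ω‖ₑ ∂μ ≤ ENNReal.ofReal r * ‖v‖ₑ)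
    (v : Vec d) :
    ‖(1 - γ • ∫ ω, outerCLM (x ω) ∂μ : Vec d →L[ℝ] Vec d) v‖ ≤ r * ‖v‖ := by
  have hint : Integrable (fun ω => (γ * inner ℝ (x ω) v) • x ω) μ := by
    have : Integrable (fun ω => γ • (inner ℝ (x ω) v : ℝ) • x ω) μ :=
      ((integrable_outerCLM hx).apply_continuousLinearMap v).smul γ
    simpa only [mul_smul] using this
  have h1 : (1 - γ • ∫ ω, outerCLM (x ω) ∂μ : Vec d →L[ℝ] Vec d) v =
      ∫ ω, (v - (γ * inner ℝ (x ω) v) • x ω) ∂μ := by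
    rw [integral_sub (integrable_const _) hint]
    simp only [mul_smul, integral_smul, sub_apply, one_apply_eq_self, smul_apply,
      integral_outerCLM_apply hx, integral_const, probReal_univ, one_smul]
  have h2 := (enorm_integral_le_lintegral_enorm
    (fun ω => v - (γ * inner ℝ (x ω) v) • x ω) (μ := μ)).trans (hc v)
  rw [← h1, ← ofReal_norm, ← ofReal_norm, ← ENNReal.ofReal_mul hr] at h2
  exact (ENNReal.ofReal_le_ofReal_iff (by positivity)).mp h2

/-! ### Means of the product estimator and of the single term estimator -/

/-- In coordinates each term is a sum of `Z_a Z'_b x_a x_b`, and independence splits its mean into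
`E(Z_a) E(Z'_b) H_ab`. Integrability of `Z` and square-integrability of `x` suffice. -/
theorem integral_sqBiasEstimator {Ω₀ Ω : Type*} [MeasurableSpace Ω₀] [MeasurableSpace Ω]
    {μ₀ : Measure Ω₀} {μ : Measure Ω} {d : ℕ} {x : Ω₀ → Vec d} (hx : MemLp x 2 μ₀)
    {Z Z' : Ω → Vec d} (hZ : Integrable Z μ) (hZ' : IdentDistrib Z' Z μ μ) {n' : ℕ} (hn' : 1 ≤ n')
    {X : Fin n' → Ω → Vec d} (hX : ∀ j, IdentDistrib (X j) x μ μ₀)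
    (hind : iIndepFun (Fin.cons Z (Fin.cons Z' X) : Fin (n' + 2) → Ω → Vec d) μ) :
    Integrable (sqBiasEstimator Z Z' X) μ ∧
      ∫ ω, sqBiasEstimator Z Z' X ω ∂μ =
        (∫ ω, Z ω ∂μ).ofLp ⬝ᵥ (hessian μ₀ x *ᵥ (∫ ω, Z ω ∂μ).ofLp) := by
  have hZ'i : Integrable Z' μ := hZ'.integrable_iff.mpr hZ
  have hmeas : ∀ i, AEMeasurable ((Fin.cons Z (Fin.cons Z' X) : Fin (n' + 2) → Ω → Vec d) i) μ :=
    fun i => by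
      refine Fin.cases ?_ (fun i => Fin.cases ?_ (fun i => ?_) i) i
      · exact hZ.aemeasurable
      · exact hZ'i.aemeasurable
      · exact (hX i).aemeasurable_fst
  have hcoord : ∀ a : Fin d, Measurable fun v : Vec d => v a := fun a => by fun_prop
  have hint : ∀ {V : Ω → Vec d}, Integrable V μ → ∀ a, Integrable (fun ω => V ω a) μ :=
    fun hV a => (EuclideanSpace.proj (𝕜 := ℝ) a).integrable_comp hV
  have hval : ∀ {V : Ω → Vec d}, Integrable V μ → ∀ a, ∫ ω, V ω a ∂μ = (∫ ω, V ω ∂μ) a :=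
    fun hV a => (EuclideanSpace.proj (𝕜 := ℝ) a).integral_comp_comm hV
  have hZZ' : IndepFun Z Z' μ := hind.indepFun (i := 0) (j := 1) (by simp)
  have hterm : ∀ j, Integrable (fun ω => inner ℝ (Z ω) (X j ω) * inner ℝ (Z' ω) (X j ω)) μ ∧
      ∫ ω, inner ℝ (Z ω) (X j ω) * inner ℝ (Z' ω) (X j ω) ∂μ =
        (∫ ω, Z ω ∂μ).ofLp ⬝ᵥ (hessian μ₀ x *ᵥ (∫ ω, Z ω ∂μ).ofLp) := by
    intro j
    have hXL : MemLp (X j) 2 μ := (hX j).memLp_iff.mpr hx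
    have hpair : IndepFun (fun ω => (Z ω, Z' ω)) (X j) μ :=
      hind.indepFun_prodMk₀ hmeas 0 1 j.succ.succ (Fin.succ_ne_zero _).symm
        (by simp [Fin.ext_iff])
    have hXX : ∀ a b, Integrable (fun ω => X j ω a * X j ω b) μ :=
      fun a b => matrixIntegrable_outer hXL a b
    have hH : ∀ a b, ∫ ω, X j ω a * X j ω b ∂μ = hessian μ₀ x a b := fun a b =>
      ((hX j).comp (u := fun v : Vec d => v a * v b) (by fun_prop)).integral_eq
    have hab : ∀ a b, IndepFun (fun ω => Z ω a * Z' ω b) (fun ω => X j ω a * X j ω b) μ :=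
      fun a b => hpair.comp (φ := fun p : Vec d × Vec d => p.1 a * p.2 b)
        (ψ := fun v : Vec d => v a * v b) (by fun_prop) (by fun_prop)
    have hzab : ∀ a b, IndepFun (fun ω => Z ω a) (fun ω => Z' ω b) μ :=
      fun a b => hZZ'.comp (hcoord a) (hcoord b)
    have hZab : ∀ a b, Integrable (fun ω => Z ω a * Z' ω b) μ := fun a b =>
      (hzab a b).integrable_mul (hint hZ a) (hint hZ'i b)
    have hI : ∀ a b, Integrable (fun ω => Z ω a * Z' ω b * (X j ω a * X j ω b)) μ := fun a b =>
      (hab a b).integrable_mul (hZab a b) (hXX a b)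
    have heq : (fun ω => inner ℝ (Z ω) (X j ω) * inner ℝ (Z' ω) (X j ω)) =
        fun ω => ∑ a, ∑ b, Z ω a * Z' ω b * (X j ω a * X j ω b) := by
      ext1 ω
      simp only [PiLp.inner_apply, RCLike.inner_apply, conj_trivial, Finset.sum_mul_sum]
      exact Finset.sum_congr rfl fun a _ => Finset.sum_congr rfl fun b _ => by ring
    rw [heq]
    refine ⟨integrable_finsetSum _ fun a _ => integrable_finsetSum _ fun b _ => hI a b, ?_⟩
    rw [integral_finsetSum _ fun a _ => integrable_finsetSum _ fun b _ => hI a b]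
    simp only [dotProduct, Matrix.mulVec, Finset.mul_sum]
    refine Finset.sum_congr rfl fun a _ => ?_
    rw [integral_finsetSum _ fun b _ => hI a b]
    refine Finset.sum_congr rfl fun b _ => ?_
    rw [(hab a b).integral_fun_mul_eq_mul_integral (hZab a b).1 (hXX a b).1,
      (hzab a b).integral_fun_mul_eq_mul_integral (hint hZ a).1 (hint hZ'i b).1, hH,
      hval hZ, hval hZ'i, hZ'.integral_eq]
    ring
  refine ⟨(integrable_finsetSum _ fun j _ => (hterm j).1).const_mul _, ?_⟩
  simp only [sqBiasEstimator]
  rw [integral_const_mul, integral_finsetSum _ fun j _ => (hterm j).1]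
  have : (n' : ℝ) ≠ 0 := by positivity
  simp only [(hterm _).2, Finset.sum_const, Finset.card_univ, Fintype.card_fin, nsmul_eq_mul]
  field_simp

theorem measurable_levelVec {Ω : Type*} [MeasurableSpace Ω] {d : ℕ} {γ : ℝ} {θ0 : Vec d}
    {xs : ℤ → Ω → Vec d} {ys : ℤ → Ω → ℝ} {τ : ℕ → Ω → ℕ} (hxs : ∀ t, Measurable (xs t))
    (hys : ∀ t, Measurable (ys t)) (hτ : ∀ l, Measurable (τ l)) (l : ℕ) :
    Measurable (levelVec γ θ0 xs ys τ l) :=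
  (measurable_from_prod_countable_right (measurable_backIterate (γ := γ) (θ0 := θ0) hxs hys) :
    Measurable fun p : ℕ × Ω => backIterate γ θ0 xs ys p.1 p.2).comp ((hτ l).prodMk measurable_id)

/-- The mean of the single term estimator, from the means of the levels. -/
theorem integral_singleTerm {Ω : Type*} [MeasurableSpace Ω] {μ : Measure Ω}
    [IsProbabilityMeasure μ] {d : ℕ} {γ δ : ℝ} {θ0 : Vec d} {xs : ℤ → Ω → Vec d}
    {ys : ℤ → Ω → ℝ} (hxs : ∀ t, Measurable (xs t)) (hys : ∀ t, Measurable (ys t))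
    {τ : ℕ → Ω → ℕ} (hτ : ∀ l, Measurable (τ l)) {N : Ω → ℕ} (hN : Measurable N) (hδ : 1 < δ)
    (hN_law : ∀ l, μ.real {ω | N ω = l} = levelProb δ l)
    (hN_indep : IndepFun N (fun ω => (fun l => τ l ω, fun t => (xs t ω, ys t ω))) μ)
    (hint : ∀ l, Integrable (levelVec γ θ0 xs ys τ l) μ)
    (hsum : ∑' l, ∫⁻ ω, ‖levelVec γ θ0 xs ys τ (l + 1) ω - levelVec γ θ0 xs ys τ l ω‖ₑ ∂μ ≠ ⊤)
    {θ : Vec d} (hlim : Filter.Tendsto (fun l => ∫ ω, levelVec γ θ0 xs ys τ l ω ∂μ)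
      Filter.atTop (nhds θ)) :
    Integrable (singleTerm γ δ θ0 xs ys τ N) μ ∧
      ∫ ω, singleTerm γ δ θ0 xs ys τ N ω ∂μ = θ - ∫ ω, levelVec γ θ0 xs ys τ 0 ω ∂μ := by
  -- The level vectors on the canonical space of start times and data: composing with them transfers
  -- the independence of `N`.
  let φ : ℕ → (ℕ → ℕ) × (ℤ → Vec d × ℝ) → Vec d :=
    levelVec γ θ0 (fun t p => (p.2 t).1) (fun t p => (p.2 t).2) (fun l p => p.1 l)
  have hφ : ∀ l, Measurable (φ l) :=
    measurable_levelVec (fun t => by fun_prop) (fun t => by fun_prop) (fun l => by fun_prop)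
  let G : ℕ → Ω → Vec d := fun l ω =>
    (levelProb δ l)⁻¹ • (levelVec γ θ0 xs ys τ (l + 1) ω - levelVec γ θ0 xs ys τ l ω)
  have hψ : ∀ l, Measurable fun p => (levelProb δ l)⁻¹ • (φ (l + 1) p - φ l p) := fun l =>
    ((hφ (l + 1)).sub (hφ l)).const_smul (levelProb δ l)⁻¹
  have hG : ∀ l, Measurable (G l) := fun l =>
    ((measurable_levelVec hxs hys hτ (l + 1)).sub (measurable_levelVec hxs hys hτ l)).const_smul
      (levelProb δ l)⁻¹
  have hind : ∀ l, IndepFun N (G l) μ := fun l => hN_indep.comp measurable_id (hψ l)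
  have hp := levelProb_pos hδ
  -- The probability of level `l` cancels the factor `1 / p_l`, so the decay of `p_l` plays no role
  -- in first moments.
  have henorm : ∀ l, μ {ω | N ω = l} * ∫⁻ ω, ‖G l ω‖ₑ ∂μ =
      ∫⁻ ω, ‖levelVec γ θ0 xs ys τ (l + 1) ω - levelVec γ θ0 xs ys τ l ω‖ₑ ∂μ := fun l => by
    rw [← ofReal_measureReal, hN_law]
    simp only [G, enorm_smul]
    rw [lintegral_const_mul' _ _ enorm_ne_top, ← mul_assoc, ← ofReal_norm,
      Real.norm_of_nonneg (inv_nonneg.mpr (hp l).le), ← ENNReal.ofReal_mul (hp l).le,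
      mul_inv_cancel₀ (hp l).ne', ENNReal.ofReal_one, one_mul]
  obtain ⟨h1, h2⟩ := integrable_randomIndex hN hG hind (by simpa only [henorm] using hsum)
  refine ⟨h1, tendsto_nhds_unique h2.tendsto_sum_nat ?_⟩
  have hterm : ∀ l, μ.real {ω | N ω = l} • ∫ ω, G l ω ∂μ =
      ∫ ω, levelVec γ θ0 xs ys τ (l + 1) ω ∂μ - ∫ ω, levelVec γ θ0 xs ys τ l ω ∂μ := fun l => by
    simp only [G]
    rw [hN_law, integral_smul, smul_smul, mul_inv_cancel₀ (hp l).ne', one_smul,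
      integral_sub (hint _) (hint _)]
  simp only [hterm, Finset.sum_range_sub fun l => ∫ ω, levelVec γ θ0 xs ys τ l ω ∂μ]
  exact hlim.sub_const _

theorem mainTheorem6
    {Ω₀ Ω : Type*} [MeasurableSpace Ω₀] [MeasurableSpace Ω]
    (μ₀ : Measure Ω₀) [IsProbabilityMeasure μ₀] (μ : Measure Ω) [IsProbabilityMeasure μ]
    {d : ℕ}
    -- the square-integrable pair `(x, y)`
    (x : Ω₀ → Vec d) (y : Ω₀ → ℝ) (hx : MemLp x 2 μ₀) (hy : MemLp y 2 μ₀)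
    (hH : (hessian μ₀ x).PosDef)
    (θstar : Vec d) (hθstar : NormalEquation μ₀ x y θstar)
    (σ R : ℝ) (hA : MomentAssumption μ₀ x y θstar σ R)
    -- the step-size, the initial vector, and the exponent of the level probabilities
    (γ : ℝ) (hγ_pos : 0 < γ) (hγ_lt : γ < 2 / R ^ 2) (θ0 : Vec d)
    (δ : ℝ) (hδ : 1 < δ)
    -- the burn-in period `s = α k`, rounded up or down
    (α : ℝ) (hα_pos : 0 < α) (hα_le : α ≤ 1 / 2)
    (k : ℕ) (hk : 2 ≤ k)
    (s : ℕ) (hs_ge : ⌊α * k⌋₊ ≤ s) (hs_le : s ≤ ⌈α * k⌉₊)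
    -- independent copies `(x_t, y_t)`, `t ∈ ℤ`, of `(x, y)`
    (xs : ℤ → Ω → Vec d) (ys : ℤ → Ω → ℝ)
    (hxs : ∀ t, Measurable (xs t)) (hys : ∀ t, Measurable (ys t))
    (hcopy : ∀ t, IdentDistrib (fun ω => (xs t ω, ys t ω)) (fun ω => (x ω, y ω)) μ μ₀)
    (hindep : iIndepFun (fun t ω => (xs t ω, ys t ω)) μ)
    -- the variables `τ(k,l)`, uniform, independent of each other and of the data
    (τ : ℕ → Ω → ℕ) (hτ : ∀ l, Measurable (τ l))
    (hτ_law : ∀ l, HasLaw (τ l) (uniformOn (startRange s k l : Set ℕ)) μ)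
    (hτ_indep : iIndepFun τ μ)
    (hτ_data : IndepFun (fun ω l => τ l ω) (fun ω t => (xs t ω, ys t ω)) μ)
    -- the random level `N`, independent of all of the above
    (N : Ω → ℕ) (hN : Measurable N)
    (hN_law : ∀ l, μ.real {ω | N ω = l} = levelProb δ l)
    (hN_indep : IndepFun N (fun ω => (fun l => τ l ω, fun t => (xs t ω, ys t ω))) μ)
    -- `Z` is `Z_k`, `Z'` is a copy of it, `X 0, …, X (n' - 1)` are copies of `x`
    (Z : Ω → Vec d) (hZ : Z = singleTerm γ δ θ0 xs ys τ N)
    (Z' : Ω → Vec d) (hZ' : IdentDistrib Z' Z μ μ)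
    (n' : ℕ) (hn' : 1 ≤ n')
    (X : Fin n' → Ω → Vec d) (hX : ∀ j, IdentDistrib (X j) x μ μ₀)
    (hZX_indep : iIndepFun (Fin.cons Z (Fin.cons Z' X) : Fin (n' + 2) → Ω → Vec d) μ) :
    Integrable (thetaBar γ θ0 xs ys s k) μ ∧
      Integrable (sqBiasEstimator Z Z' X) μ ∧
      ∫ ω, sqBiasEstimator Z Z' X ω ∂μ =
        weightedNorm (hessian μ₀ x) (∫ ω, thetaBar γ θ0 xs ys s k ω ∂μ - θstar) ^ 2 := by
  have h : IsIIDData μ₀ μ x y xs ys := ⟨hx, hy, hxs, hys, hcopy, hindep⟩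
  have hsk := tail_lt hα_le hk hs_le
  obtain ⟨r, hr0, hr1, hc⟩ := exists_lintegral_step_le hx hH hA.R_pos
    hA.integrable_fourth hA.fourth_le hγ_pos hγ_lt
  have hθ : (∫ ω, outerCLM (x ω) ∂μ₀) θstar = ∫ ω, y ω • x ω ∂μ₀ :=
    (integral_outerCLM_eq_hessian hx θstar).trans hθstar
  have hAn := norm_pow_apply_le hr0 (norm_one_sub_integral_outerCLM_le hx hr0 hc)
  have hind : ∀ l n, IndepFun (τ l) (backIterate γ θ0 xs ys n) μ := fun l n => by
    have := measurable_backIterate (γ := γ) (θ0 := θ0)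
      (xs := fun t (z : ℤ → Vec d × ℝ) => (z t).1) (ys := fun t z => (z t).2)
      (fun t => by fun_prop) (fun t => by fun_prop) n
    exact hτ_data.comp (measurable_pi_apply l) this
  have hlevel := fun l => h.integral_backIterate_uniform γ θ0 θstar hθ (hτ l) (hτ_law l) (hind l)
  have hge : ∀ l, ∀ᵐ ω ∂μ, l ≤ τ l ω := fun l => by
    have : ∀ᵐ n ∂μ.map (τ l), l ≤ n := by
      rw [(hτ_law l).map_eq]
      filter_upwards [ae_cond_mem (μ := Measure.count)
        (Finset.measurableSet (startRange s k l))] with n hn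
      exact le_of_mem_startRange hk hn
    exact ae_of_ae_map (hτ l).aemeasurable this
  have hC : ∫⁻ ω, ‖(γ * (inner ℝ (x ω) θ0 - y ω)) • x ω‖ₑ ∂μ₀ ≠ ⊤ := by
    have h1 : MemLp (fun ω => γ * (inner ℝ (x ω) θ0 - y ω)) 2 μ₀ :=
      ((hx.inner_const θ0).sub hy).const_mul γ
    exact (memLp_one_iff_integrable.mp (hx.smul h1)).2.ne
  have hr1' : ENNReal.ofReal r < 1 := by simpa using hr1
  have hinv : (1 - ENNReal.ofReal r)⁻¹ ≠ ⊤ :=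
    ENNReal.inv_ne_top.mpr (tsub_pos_of_lt hr1').ne'
  have hsum : ∑' l, ∫⁻ ω,
      ‖levelVec γ θ0 xs ys τ (l + 1) ω - levelVec γ θ0 xs ys τ l ω‖ₑ ∂μ ≠ ⊤ := by
    -- Both `τ_l` and `τ_{l+1}` are at least `l`, so the level difference is of order `r ^ l`.
    refine ne_top_of_le_ne_top ?_ (ENNReal.tsum_le_tsum fun l =>
      h.lintegral_backIterate_sub_le hc θ0 ((hge (l + 1)).mono fun ω hω => (Nat.le_succ l).trans hω)
        (hge l))
    rw [ENNReal.tsum_mul_left, ENNReal.tsum_geometric]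
    exact ENNReal.mul_ne_top (ENNReal.mul_ne_top hC hinv) hinv
  have hlim : Filter.Tendsto (fun l => ∫ ω, levelVec γ θ0 xs ys τ l ω ∂μ)
      Filter.atTop (nhds θstar) := by
    rw [tendsto_iff_norm_sub_tendsto_zero]
    refine squeeze_zero (fun _ => norm_nonneg _) (g := fun l => r ^ l * ‖θ0 - θstar‖)
      (fun l => ?_) ?_
    · refine (congrArg (fun v => ‖v - θstar‖) (hlevel l).2).trans_le
        (norm_average_add_sub_le (startRange_nonempty hsk l) θstar _ fun n hn => ?_)
      exact (hAn n _).trans (mul_le_mul_of_nonneg_right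
        (pow_le_pow_of_le_one hr0 hr1.le (le_of_mem_startRange hk hn)) (norm_nonneg _))
    · simpa using (tendsto_pow_atTop_nhds_zero_of_lt_one hr0 hr1).mul_const ‖θ0 - θstar‖
  obtain ⟨hZi, hZm⟩ := integral_singleTerm hxs hys hτ hN hδ hN_law hN_indep
    (fun l => (hlevel l).1) hsum hlim
  have hsgd := fun t : ℕ => h.integral_sgdSteps γ θ0 θstar hθ 0 t
  have hbar : thetaBar γ θ0 xs ys s k = fun ω => ((k : ℝ) - s)⁻¹ •
      ∑ t ∈ Finset.Ico s k, sgdSteps γ θ0 (fun i => xs i ω) (fun i => ys i ω) 0 t := by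
    ext1 ω
    simp [thetaBar, sgd]
  -- `θ_t` and `θ_{-t:0}` take the same number of steps, and `τ_0` is uniform on the averaging
  -- window.
  have hbarm : ∫ ω, thetaBar γ θ0 xs ys s k ω ∂μ = ∫ ω, levelVec γ θ0 xs ys τ 0 ω ∂μ := by
    refine Eq.trans ?_ (hlevel 0).2.symm
    rw [hbar, integral_smul, integral_finsetSum _ fun t _ => (hsgd t).1]
    simp only [(hsgd _).2, startRange, Nat.card_Ico, Nat.cast_sub hsk.le]
  rw [← hZ] at hZi hZm
  obtain ⟨hi, hm⟩ := integral_sqBiasEstimator hx hZi hZ' hn' hX hZX_indep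
  refine ⟨?_, hi, ?_⟩
  · rw [hbar]
    exact Integrable.smul (((k : ℝ) - s)⁻¹) (f := fun ω => ∑ t ∈ Finset.Ico s k,
      sgdSteps γ θ0 (fun i => xs i ω) (fun i => ys i ω) 0 t)
      (integrable_finsetSum _ fun t _ => (hsgd t).1)
  -- `E(Z)` is minus the bias; the quadratic form does not see the sign.
  · rw [weightedNorm_sq hH.posSemidef, hm, hZm, hbarm,
      ← neg_sub (∫ ω, levelVec γ θ0 xs ys τ 0 ω ∂μ) θstar]
    simp only [WithLp.ofLp_neg, Matrix.mulVec_neg, dotProduct_neg, neg_dotProduct, neg_neg]
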